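/- Let $\mathbb F$ be a field. A (right) Leibniz algebra is an $\mathbb F$-vector space $\mathfrak g$ with a bilinear bracket satisfying $[x,[y,z]]=[[x,y],z]-[[x,z],y]$. Write $\mathfrak g^2$ for the linear span of all brackets, $\mathfrak g^{ab}=\mathfrak g/\mathfrak g^2$, and $Z(\mathfrak g)=\{z : [z,x]=[x,z]=0 \text{ for all } x\in\mathfrak g\}$. The second homology is $$HL_2(\mathfrak g)=\ker(\partial_2:\mathfrak g^{\otimes 2}\to\mathfrak g)\,/\,\operatorname{im}(\partial_3:\mathfrak g^{\otimes 3}\to\mathfrak g^{\otimes 2}),$$ where $\partial_2(x\otimes y)=[x,y]$ and $\partial_3(x\otimes y\otimes z)=[x,y]\otimes z-[x,z]\otimes y-x\otimes[y,z]$. A (stem) cover of $\mathfrak g$ is a Leibniz algebra $\mathfrak m$ together with a surjective homomorphism $\delta:\mathfrak m\to\mathfrak g$ such that $\ker\delta\subseteq Z(\mathfrak m)\cap\mathfrak m^2$ and $\ker\delta\cong HL_2(\mathfrak g)$. For two Leibniz algebras $\mathfrak a,\mathfrak b$ acting on each other, the non-abelian tensor product $\mathfrak a\ast\mathfrak b$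 is the Leibniz algebra generated by the symbols $a\ast b$ and $b\ast a$ ($a\in\mathfrak a$, $b\in\mathfrak b$), bilinear in their entries, subject, for all $a,a'\in\mathfrak a$, $b,b'\in\mathfrak b$ (writing ${}^{x}y$ and $y^{x}$ for the left and right action of $x$ on $y$), to $$a\ast[b,b']=a^{b}\ast b'-a^{b'}\ast b,\qquad [a,a']\ast b={}^{a}b\ast a'-a\ast b^{a'},\qquad a\ast{}^{a'}b=-a\ast b^{a'},$$ $$a^{b}\ast{}^{a'}b'=[a\ast b,a'\ast b']={}^{a}b\ast a'^{\,b'},\qquad a^{b}\ast b'^{\,a'}=[a\ast b,b'\ast a']={}^{a}b\ast{}^{b'}a',$$ and to the relations obtained from all of these by exchanging the roles of $\mathfrak a$ and $\mathfrak b$. When it is applied to $\mathfrak m_1^{ab}$ and $\mathfrak m_2^{ab}$ below, the two factors act trivially on each other. Let $\mathfrak g_1,\mathfrak g_2$ be Leibniz algebras over $\mathbb F$, and let $\delta_i:\mathfrak m_i\to\mathfrak g_i$ be a cover of $\mathfrak g_i$ for $i=1,2$. Then the vector space $$\mathfrak m=\mathfrak m_1\dotplus\mathfrak m_2\dotplus(\mathfrak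 m_1^{ab}\ast\mathfrak m_2^{ab})$$ with the multiplication $$[(m_1,m_2,z),(m_1',m_2',z')]=\bigl([m_1,m_1'],\,[m_2,m_2'],\,\bar m_1'\ast\bar m_2-\bar m_2'\ast\bar m_1\bigr),$$ where bars denote classes in $\mathfrak m_i^{ab}$, is a Leibniz algebra and, together with the map $(m_1,m_2,z)\mapsto(\delta_1(m_1),\delta_2(m_2))$, is a cover of $\mathfrak g_1\oplus\mathfrak g_2$. -/

import Mathlib

open scoped TensorProduct

noncomputable section

/-! ### Right Leibniz algebras -/

/-- A (right) Leibniz algebra over the field `F`: a vector space with a bilinear bracket such that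
`[x,[y,z]] = [[x,y],z] - [[x,z],y]`. -/
class LeibnizAlgebra (F : Type*) (L : Type*) [Field F] [AddCommGroup L] [Module F L]
    extends Bracket L L where
  add_br : ∀ x y z : L, ⁅x + y, z⁆ = ⁅x, z⁆ + ⁅y, z⁆
  br_add : ∀ x y z : L, ⁅x, y + z⁆ = ⁅x, y⁆ + ⁅x, z⁆
  smul_br : ∀ (c : F) (x y : L), ⁅c • x, y⁆ = c • ⁅x, y⁆
  br_smul : ∀ (c : F) (x y : L), ⁅x, c • y⁆ = c • ⁅x, y⁆
  leibniz : ∀ x y z : L, ⁅x, ⁅y, z⁆⁆ = ⁅⁅x, y⁆, z⁆ - ⁅⁅x, z⁆, y⁆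

namespace LeibnizAlgebra

section Basic

variable (F : Type*) (L : Type*) [Field F] [AddCommGroup L] [Module F L] [LeibnizAlgebra F L]

/-- The bracket as a bilinear map. -/
def br : L →ₗ[F] L →ₗ[F] L :=
  LinearMap.mk₂ F (fun x y => ⁅x, y⁆) (add_br (F := F)) smul_br (br_add (F := F)) br_smul

@[simp] theorem br_apply (x y : L) : br F L x y = ⁅x, y⁆ := rfl

theorem zero_br (x : L) : ⁅(0 : L), x⁆ = 0 := by
  rw [← br_apply F L, map_zero, LinearMap.zero_apply]

theorem br_zero (x : L) : ⁅x, (0 : L)⁆ = 0 := by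
  rw [← br_apply F L, map_zero]

/-- The derived subalgebra `L² = [L, L]`: the linear span of all brackets. -/
def derived : Submodule F L := Submodule.span F {z | ∃ x y : L, z = ⁅x, y⁆}

theorem br_mem_derived (x y : L) : ⁅x, y⁆ ∈ derived F L :=
  Submodule.subset_span ⟨x, y, rfl⟩

/-- The center: the elements `z` with `[z,x] = 0 = [x,z]` for all `x`. -/
def center : Submodule F L where
  carrier := {z | ∀ x : L, ⁅z, x⁆ = 0 ∧ ⁅x, z⁆ = 0}
  zero_mem' := fun x => ⟨zero_br F L x, br_zero F L x⟩
  add_mem' := fun {a b} ha hb x => by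
    rw [add_br (F := F), br_add (F := F), (ha x).1, (ha x).2, (hb x).1, (hb x).2]; simp
  smul_mem' := fun c a ha x => by
    rw [smul_br, br_smul, (ha x).1, (ha x).2]; simp

end Basic

/-- The bilinear multiplication induced by `b` on the quotient `V ⧸ I` by a two-sided ideal `I`. -/
def quotientMul {F V : Type*} [Field F] [AddCommGroup V] [Module F V]
    (b : V →ₗ[F] V →ₗ[F] V) (I : Submodule F V)
    (hl : ∀ x y, x ∈ I → b x y ∈ I) (hr : ∀ x y, y ∈ I → b x y ∈ I) :
    V ⧸ I →ₗ[F] V ⧸ I →ₗ[F] V ⧸ I :=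
  I.liftQ
    ({ toFun := fun x => I.liftQ (I.mkQ ∘ₗ b x) (fun y hy => by simpa using hr x y hy)
       map_add' := fun x x' => by ext y; simp
       map_smul' := fun c x => by ext y; simp } : V →ₗ[F] V ⧸ I →ₗ[F] V ⧸ I)
    (fun x hx => by
      rw [LinearMap.mem_ker]
      ext y
      simpa using hl x y hx)

@[simp] theorem quotientMul_mk {F V : Type*} [Field F] [AddCommGroup V] [Module F V]
    (b : V →ₗ[F] V →ₗ[F] V) (I : Submodule F V)
    (hl : ∀ x y, x ∈ I → b x y ∈ I) (hr : ∀ x y, y ∈ I → b x y ∈ I) (x y : V) :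
    quotientMul b I hl hr (I.mkQ x) (I.mkQ y) = I.mkQ (b x y) := rfl

/-! ### Abelianization -/

section Abelianization

variable (F : Type*) (L : Type*) [Field F] [AddCommGroup L] [Module F L] [LeibnizAlgebra F L]

/-- The abelianization `L^ab = L / L²`. -/
abbrev Ab : Type _ := L ⧸ derived F L

/-- The bracket that `L` induces on the quotient `L / L²`. -/
instance instAb : LeibnizAlgebra F (Ab F L) where
  bracket x y := quotientMul (br F L) (derived F L)
    (fun x y _ => br_mem_derived F L x y) (fun x y _ => br_mem_derived F L x y) x y
  add_br x y z := by simp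
  br_add x y z := by simp
  smul_br c x y := by simp
  br_smul c x y := by simp
  leibniz x y z := by
    obtain ⟨x, rfl⟩ := Submodule.mkQ_surjective _ x
    obtain ⟨y, rfl⟩ := Submodule.mkQ_surjective _ y
    obtain ⟨z, rfl⟩ := Submodule.mkQ_surjective _ z
    exact congrArg (derived F L).mkQ (leibniz (F := F) x y z)

/-- The class in `L^ab` of an element of `L`. -/
abbrev toAb : L →ₗ[F] Ab F L := (derived F L).mkQ

theorem toAb_br (x y : L) : toAb F L ⁅x, y⁆ = 0 := by
  simpa using br_mem_derived F L x y

theorem ab_br_eq_zero (x y : Ab F L) : ⁅x, y⁆ = 0 := by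
  obtain ⟨x, rfl⟩ := Submodule.mkQ_surjective _ x
  obtain ⟨y, rfl⟩ := Submodule.mkQ_surjective _ y
  exact toAb_br F L x y

end Abelianization

/-! ### Direct sums -/

/-- The direct sum of two Leibniz algebras, with the componentwise bracket. -/
instance instProd {F L₁ L₂ : Type*} [Field F] [AddCommGroup L₁] [Module F L₁]
    [AddCommGroup L₂] [Module F L₂] [LeibnizAlgebra F L₁] [LeibnizAlgebra F L₂] :
    LeibnizAlgebra F (L₁ × L₂) where
  bracket x y := (⁅x.1, y.1⁆, ⁅x.2, y.2⁆)
  add_br x y z := by ext <;> simp [add_br (F := F)]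
  br_add x y z := by ext <;> simp [br_add (F := F)]
  smul_br c x y := by ext <;> simp [smul_br]
  br_smul c x y := by ext <;> simp [br_smul]
  leibniz x y z := by ext <;> simp [leibniz (F := F)]

/-! ### Second Leibniz homology with trivial coefficients

The Leibniz complex of `L` has `CL_n = L^{⊗ n}` and
`∂(x₁ ⊗ ⋯ ⊗ xₙ) = ∑_{i < j} (-1)^j x₁ ⊗ ⋯ ⊗ [xᵢ, xⱼ] ⊗ ⋯ ⊗ x̂ⱼ ⊗ ⋯ ⊗ xₙ`.
Only the degrees 3, 2, 1 enter the second homology. -/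

section Homology

variable (F : Type*) (L : Type*) [Field F] [AddCommGroup L] [Module F L] [LeibnizAlgebra F L]

/-- `∂₂ (x ⊗ y) = [x, y]`. -/
def boundary₂ : L ⊗[F] L →ₗ[F] L := TensorProduct.lift (br F L)

/-- `∂₃ (x ⊗ y ⊗ z) = [x,y] ⊗ z - [x,z] ⊗ y - x ⊗ [y,z]`. -/
def boundary₃ : (L ⊗[F] L) ⊗[F] L →ₗ[F] L ⊗[F] L :=
  (boundary₂ F L).rTensor L
    - (boundary₂ F L).rTensor L ∘ₗ (TensorProduct.rightComm F L L L).toLinearMap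
    - (boundary₂ F L).lTensor L ∘ₗ (TensorProduct.assoc F L L L).toLinearMap

@[simp] theorem boundary₂_tmul (x y : L) : boundary₂ F L (x ⊗ₜ y) = ⁅x, y⁆ := rfl

@[simp] theorem boundary₃_tmul (x y z : L) : boundary₃ F L ((x ⊗ₜ y) ⊗ₜ z) =
    ⁅x, y⁆ ⊗ₜ z - ⁅x, z⁆ ⊗ₜ y - x ⊗ₜ ⁅y, z⁆ := by
  simp [boundary₃]

theorem boundary₂_comp_boundary₃ : boundary₂ F L ∘ₗ boundary₃ F L = 0 := by
  ext x y z
  simp [leibniz (F := F) x y z]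

/-- The second Leibniz homology `HL₂(L) = ker ∂₂ / im ∂₃`. -/
abbrev HL₂ : Type _ :=
  LinearMap.ker (boundary₂ F L) ⧸
    (LinearMap.range (boundary₃ F L)).submoduleOf (LinearMap.ker (boundary₂ F L))

end Homology

/-! ### Actions and the non-abelian tensor product -/

/-- An action of the Leibniz algebra `G` on the Leibniz algebra `M`:
`left x m` is `ˣm` and `right m x` is `mˣ`. -/
structure Action (F G M : Type*) [Field F] [AddCommGroup G] [Module F G] [LeibnizAlgebra F G]
    [AddCommGroup M] [Module F M] [LeibnizAlgebra F M] where
  left : G →ₗ[F] M →ₗ[F] M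
  right : M →ₗ[F] G →ₗ[F] M
  left_br : ∀ (x x' : G) (m : M), left ⁅x, x'⁆ m = left x (left x' m) + right (left x m) x'
  right_br : ∀ (m : M) (x x' : G), right m ⁅x, x'⁆ = right (right m x) x' - right (right m x') x
  left_left : ∀ (x x' : G) (m : M), left x (left x' m) = - left x (right m x')
  br_left : ∀ (x : G) (m m' : M), left x ⁅m, m'⁆ = ⁅left x m, m'⁆ - ⁅left x m', m⁆
  br_right : ∀ (m m' : M) (x : G), right ⁅m, m'⁆ x = ⁅right m x, m'⁆ + ⁅m, right m' x⁆
  br_left_right : ∀ (m m' : M) (x : G), ⁅m, left x m'⁆ = - ⁅m, right m' x⁆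

/-- The trivial action: `ˣm = 0 = mˣ`. -/
def Action.trivial (F G M : Type*) [Field F] [AddCommGroup G] [Module F G] [LeibnizAlgebra F G]
    [AddCommGroup M] [Module F M] [LeibnizAlgebra F M] : Action F G M where
  left := 0
  right := 0
  left_br := by simp
  right_br := by simp
  left_left := by simp
  br_left := by simp [zero_br F M]
  br_right := by simp [zero_br F M, br_zero F M]
  br_left_right := by simp [br_zero F M]

section Tensor

variable {F M N : Type*} [Field F] [AddCommGroup M] [Module F M] [LeibnizAlgebra F M]
  [AddCommGroup N] [Module F N] [LeibnizAlgebra F N]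

variable (F M N) in
/-- The free non-associative algebra on the symbols `m ∗ n` and `n ∗ m`. -/
abbrev FreeSymbols : Type _ := FreeNonUnitalNonAssocAlgebra F ((M × N) ⊕ (N × M))

variable (F) in
/-- The symbol `m ∗ n`. -/
def symMN (m : M) (n : N) : FreeSymbols F M N :=
  FreeNonUnitalNonAssocAlgebra.of F (Sum.inl (m, n))

variable (F) in
/-- The symbol `n ∗ m`. -/
def symNM (n : N) (m : M) : FreeSymbols F M N :=
  FreeNonUnitalNonAssocAlgebra.of F (Sum.inr (n, m))

/-- The defining relations of the non-abelian tensor product `M ∗ N`, for an action `a` of `N` on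
`M` and an action `b` of `M` on `N`, together with the Leibniz identity. -/
inductive TensorRel (a : Action F N M) (b : Action F M N) :
    FreeSymbols F M N → FreeSymbols F M N → Prop
  | leibniz (u v w) : TensorRel a b (u * (v * w)) ((u * v) * w - (u * w) * v)
  | smul_MN_left (c : F) (m n) : TensorRel a b (c • symMN F m n) (symMN F (c • m) n)
  | smul_MN_right (c : F) (m n) : TensorRel a b (c • symMN F m n) (symMN F m (c • n))
  | smul_NM_left (c : F) (n m) : TensorRel a b (c • symNM F n m) (symNM F (c • n) m)
  | smul_NM_right (c : F) (n m) : TensorRel a b (c • symNM F n m) (symNM F n (c • m))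
  | add_MN_left (m m' n) : TensorRel a b (symMN F (m + m') n) (symMN F m n + symMN F m' n)
  | add_NM_left (n n' m) : TensorRel a b (symNM F (n + n') m) (symNM F n m + symNM F n' m)
  | add_MN_right (m n n') : TensorRel a b (symMN F m (n + n')) (symMN F m n + symMN F m n')
  | add_NM_right (n m m') : TensorRel a b (symNM F n (m + m')) (symNM F n m + symNM F n m')
  | br_MN_right (m n n') : TensorRel a b (symMN F m ⁅n, n'⁆)
      (symMN F (a.right m n) n' - symMN F (a.right m n') n)
  | br_NM_right (n m m') : TensorRel a b (symNM F n ⁅m, m'⁆)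
      (symNM F (b.right n m) m' - symNM F (b.right n m') m)
  | br_MN_left (m m' n) : TensorRel a b (symMN F ⁅m, m'⁆ n)
      (symNM F (b.left m n) m' - symMN F m (b.right n m'))
  | br_NM_left (n n' m) : TensorRel a b (symNM F ⁅n, n'⁆ m)
      (symMN F (a.left n m) n' - symNM F n (a.right m n'))
  | left_MN (m m' n) : TensorRel a b (symMN F m (b.left m' n)) (- symMN F m (b.right n m'))
  | left_NM (n n' m) : TensorRel a b (symNM F n (a.left n' m)) (- symNM F n (a.right m n'))
  | mul_MN_MN (m n m' n') : TensorRel a b (symMN F m n * symMN F m' n')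
      (symMN F (a.right m n) (b.left m' n'))
  | mul_MN_MN' (m n m' n') : TensorRel a b (symMN F m n * symMN F m' n')
      (symNM F (b.left m n) (a.right m' n'))
  | mul_NM_NM (n m n' m') : TensorRel a b (symNM F n m * symNM F n' m')
      (symMN F (a.left n m) (b.right n' m'))
  | mul_NM_NM' (n m n' m') : TensorRel a b (symNM F n m * symNM F n' m')
      (symNM F (b.right n m) (a.left n' m'))
  | mul_MN_NM (m n n' m') : TensorRel a b (symMN F m n * symNM F n' m')
      (symMN F (a.right m n) (b.right n' m'))
  | mul_MN_NM' (m n n' m') : TensorRel a b (symMN F m n * symNM F n' m')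
      (symNM F (b.left m n) (a.left n' m'))
  | mul_NM_MN (n m m' n') : TensorRel a b (symNM F n m * symMN F m' n')
      (symMN F (a.left n m) (b.left m' n'))
  | mul_NM_MN' (n m m' n') : TensorRel a b (symNM F n m * symMN F m' n')
      (symNM F (b.right n m) (a.right m' n'))

/-- The two-sided ideal of the free algebra generated by the relations: the intersection of all
two-sided ideals that contain `u - v` for every relation `u = v`. -/
def tensorIdeal (a : Action F N M) (b : Action F M N) : Submodule F (FreeSymbols F M N) :=
  sInf {I | (∀ u v, TensorRel a b u v → u - v ∈ I) ∧ (∀ u v, u ∈ I → u * v ∈ I) ∧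
    (∀ u v, v ∈ I → u * v ∈ I)}

theorem sub_mem_tensorIdeal {a : Action F N M} {b : Action F M N} {u v : FreeSymbols F M N}
    (h : TensorRel a b u v) : u - v ∈ tensorIdeal a b :=
  Submodule.mem_sInf.2 fun _ hI => hI.1 u v h

theorem mul_mem_tensorIdeal_left (a : Action F N M) (b : Action F M N) (u v : FreeSymbols F M N)
    (hu : u ∈ tensorIdeal a b) : u * v ∈ tensorIdeal a b :=
  Submodule.mem_sInf.2 fun I hI => hI.2.1 u v (Submodule.mem_sInf.1 hu I hI)

theorem mul_mem_tensorIdeal_right (a : Action F N M) (b : Action F M N) (u v : FreeSymbols F M N)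
    (hv : v ∈ tensorIdeal a b) : u * v ∈ tensorIdeal a b :=
  Submodule.mem_sInf.2 fun I hI => hI.2.2 u v (Submodule.mem_sInf.1 hv I hI)

/-- The non-abelian tensor product `M ∗ N` of two Leibniz algebras acting on each other: the Leibniz
algebra generated by the symbols `m ∗ n`, `n ∗ m` subject to the relations `TensorRel`. -/
abbrev NonabelianTensor (a : Action F N M) (b : Action F M N) : Type _ :=
  FreeSymbols F M N ⧸ tensorIdeal a b

instance instNonabelianTensor (a : Action F N M) (b : Action F M N) :
    LeibnizAlgebra F (NonabelianTensor a b) where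
  bracket x y := quotientMul (LinearMap.mul F (FreeSymbols F M N)) (tensorIdeal a b)
    (mul_mem_tensorIdeal_left a b) (mul_mem_tensorIdeal_right a b) x y
  add_br x y z := by simp
  br_add x y z := by simp
  smul_br c x y := by simp
  br_smul c x y := by simp
  leibniz x y z := by
    obtain ⟨x, rfl⟩ := Submodule.mkQ_surjective _ x
    obtain ⟨y, rfl⟩ := Submodule.mkQ_surjective _ y
    obtain ⟨z, rfl⟩ := Submodule.mkQ_surjective _ z
    exact (Submodule.Quotient.eq _).2 (sub_mem_tensorIdeal (TensorRel.leibniz x y z))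

/-- The element `m ∗ n` of `M ∗ N`, bilinear in `m` and `n`. -/
def tMN (a : Action F N M) (b : Action F M N) : M →ₗ[F] N →ₗ[F] NonabelianTensor a b :=
  LinearMap.mk₂ F (fun m n => (tensorIdeal a b).mkQ (symMN F m n))
    (fun m m' n => (Submodule.Quotient.eq _).2 (sub_mem_tensorIdeal (.add_MN_left m m' n)))
    (fun c m n => ((Submodule.Quotient.eq _).2 (sub_mem_tensorIdeal (.smul_MN_left c m n))).symm)
    (fun m n n' => (Submodule.Quotient.eq _).2 (sub_mem_tensorIdeal (.add_MN_right m n n')))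
    (fun c m n => ((Submodule.Quotient.eq _).2 (sub_mem_tensorIdeal (.smul_MN_right c m n))).symm)

/-- The element `n ∗ m` of `M ∗ N`, bilinear in `n` and `m`. -/
def tNM (a : Action F N M) (b : Action F M N) : N →ₗ[F] M →ₗ[F] NonabelianTensor a b :=
  LinearMap.mk₂ F (fun n m => (tensorIdeal a b).mkQ (symNM F n m))
    (fun n n' m => (Submodule.Quotient.eq _).2 (sub_mem_tensorIdeal (.add_NM_left n n' m)))
    (fun c n m => ((Submodule.Quotient.eq _).2 (sub_mem_tensorIdeal (.smul_NM_left c n m))).symm)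
    (fun n m m' => (Submodule.Quotient.eq _).2 (sub_mem_tensorIdeal (.add_NM_right n m m')))
    (fun c n m => ((Submodule.Quotient.eq _).2 (sub_mem_tensorIdeal (.smul_NM_right c n m))).symm)

end Tensor

/-! ### Stem covers -/

/-- `δ : M → G` is a stem cover of `G`: a surjective homomorphism of Leibniz algebras whose kernel
is contained in `Z(M) ∩ M²` and is isomorphic to `HL₂(G)`. (The kernel is central, hence abelian,
and `HL₂(G)` is an abelian Leibniz algebra, so the isomorphism is one of vector spaces.) -/
structure IsStemCover {F M G : Type*} [Field F] [AddCommGroup M] [Module F M] [LeibnizAlgebra F M]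
    [AddCommGroup G] [Module F G] [LeibnizAlgebra F G] (δ : M →ₗ[F] G) : Prop where
  map_br : ∀ x y : M, δ ⁅x, y⁆ = ⁅δ x, δ y⁆
  surjective : Function.Surjective δ
  ker_le_center : LinearMap.ker δ ≤ center F M
  ker_le_derived : LinearMap.ker δ ≤ derived F M
  ker_equiv : Nonempty (LinearMap.ker δ ≃ₗ[F] HL₂ F G)

/-! ### The twisted sum -/

section TwistedSum

variable (F M₁ M₂ : Type*) [Field F] [AddCommGroup M₁] [Module F M₁] [LeibnizAlgebra F M₁]
  [AddCommGroup M₂] [Module F M₂] [LeibnizAlgebra F M₂]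

/-- The non-abelian tensor product `M₁^ab ∗ M₂^ab`, the two factors acting trivially on each
other. -/
abbrev AbTensor : Type _ :=
  NonabelianTensor (Action.trivial F (Ab F M₂) (Ab F M₁)) (Action.trivial F (Ab F M₁) (Ab F M₂))

variable {M₁ M₂}

/-- `m̄₁ ∗ m̄₂` in `M₁^ab ∗ M₂^ab`. -/
def star₁₂ (m₁ : M₁) (m₂ : M₂) : AbTensor F M₁ M₂ :=
  tMN (Action.trivial F (Ab F M₂) (Ab F M₁)) (Action.trivial F (Ab F M₁) (Ab F M₂))
    (toAb F M₁ m₁) (toAb F M₂ m₂)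

/-- `m̄₂ ∗ m̄₁` in `M₁^ab ∗ M₂^ab`. -/
def star₂₁ (m₂ : M₂) (m₁ : M₁) : AbTensor F M₁ M₂ :=
  tNM (Action.trivial F (Ab F M₂) (Ab F M₁)) (Action.trivial F (Ab F M₁) (Ab F M₂))
    (toAb F M₂ m₂) (toAb F M₁ m₁)

variable (M₁ M₂)

/-- The vector space `M₁ ∔ M₂ ∔ (M₁^ab ∗ M₂^ab)`. -/
@[ext] structure TwistedSum where
  fst : M₁
  snd : M₂
  tensor : AbTensor F M₁ M₂

namespace TwistedSum

/-- The underlying triple. -/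
def toTriple : TwistedSum F M₁ M₂ ≃ M₁ × M₂ × AbTensor F M₁ M₂ where
  toFun x := (x.fst, x.snd, x.tensor)
  invFun x := ⟨x.1, x.2.1, x.2.2⟩
  left_inv _ := rfl
  right_inv _ := rfl

instance : AddCommGroup (TwistedSum F M₁ M₂) := (toTriple F M₁ M₂).addCommGroup

instance : Module F (TwistedSum F M₁ M₂) := (toTriple F M₁ M₂).module F

variable {F M₁ M₂}

@[simp] theorem fst_add (x y : TwistedSum F M₁ M₂) : (x + y).fst = x.fst + y.fst := rfl
@[simp] theorem snd_add (x y : TwistedSum F M₁ M₂) : (x + y).snd = x.snd + y.snd := rfl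
@[simp] theorem tensor_add (x y : TwistedSum F M₁ M₂) :
    (x + y).tensor = x.tensor + y.tensor := rfl
@[simp] theorem fst_sub (x y : TwistedSum F M₁ M₂) : (x - y).fst = x.fst - y.fst := rfl
@[simp] theorem snd_sub (x y : TwistedSum F M₁ M₂) : (x - y).snd = x.snd - y.snd := rfl
@[simp] theorem tensor_sub (x y : TwistedSum F M₁ M₂) :
    (x - y).tensor = x.tensor - y.tensor := rfl
@[simp] theorem fst_smul (c : F) (x : TwistedSum F M₁ M₂) : (c • x).fst = c • x.fst := rfl
@[simp] theorem snd_smul (c : F) (x : TwistedSum F M₁ M₂) : (c • x).snd = c • x.snd := rfl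
@[simp] theorem tensor_smul (c : F) (x : TwistedSum F M₁ M₂) :
    (c • x).tensor = c • x.tensor := rfl

/-- The twisted multiplication
`[(m₁,m₂,z),(m₁',m₂',z')] = ([m₁,m₁'], [m₂,m₂'], m̄₁' ∗ m̄₂ - m̄₂' ∗ m̄₁)`. -/
instance : LeibnizAlgebra F (TwistedSum F M₁ M₂) where
  bracket x y :=
    ⟨⁅x.fst, y.fst⁆, ⁅x.snd, y.snd⁆, star₁₂ F y.fst x.snd - star₂₁ F y.snd x.fst⟩
  add_br x y z := by
    ext <;> simp [add_br (F := F), star₁₂, star₂₁, sub_add_sub_comm]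
  br_add x y z := by
    ext <;> simp [br_add (F := F), star₁₂, star₂₁, sub_add_sub_comm]
  smul_br c x y := by
    ext <;> simp [smul_br, star₁₂, star₂₁, smul_sub]
  br_smul c x y := by
    ext <;> simp [br_smul, star₁₂, star₂₁, smul_sub]
  leibniz x y z := by
    ext
    · simpa using leibniz (F := F) x.fst y.fst z.fst
    · simpa using leibniz (F := F) x.snd y.snd z.snd
    · simp only [star₁₂, star₂₁, toAb_br, tensor_sub, map_zero, LinearMap.zero_apply, sub_zero]

variable {G₁ G₂ : Type*} [AddCommGroup G₁] [Module F G₁] [AddCommGroup G₂] [Module F G₂]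

/-- The projection `(m₁, m₂, z) ↦ (δ₁ m₁, δ₂ m₂)`. -/
def proj (δ₁ : M₁ →ₗ[F] G₁) (δ₂ : M₂ →ₗ[F] G₂) : TwistedSum F M₁ M₂ →ₗ[F] G₁ × G₂ where
  toFun x := (δ₁ x.fst, δ₂ x.snd)
  map_add' x y := by simp
  map_smul' c x := by simp

end TwistedSum

end TwistedSum

end LeibnizAlgebra

end

noncomputable section

namespace LeibnizAlgebra

open TensorProduct

/-! ### The abelianization of a stem cover -/

section Abelianization

variable {F M G : Type*} [Field F] [AddCommGroup M] [Module F M] [LeibnizAlgebra F M]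
  [AddCommGroup G] [Module F G] [LeibnizAlgebra F G]

/-! The kernel of the projection and the second homology of `G₁ × G₂` split in the same way, into
two diagonal pieces and two mixed tensor products.

The kernel is `ker δ₁ ⊕ ker δ₂ ⊕ (M₁^ab ∗ M₂^ab)`. For abelian algebras acting trivially on each
other all products in `∗` vanish, so the last summand is `(M₁^ab ⊗ M₂^ab) ⊕ (M₂^ab ⊗ M₁^ab)`
(`tensorsEquiv`). Since `ker δᵢ` lies in the derived subalgebra, `Mᵢ^ab` may be replaced by `Gᵢ^ab`
(`abEquiv`).

On the homology side (`kunnethEquiv`), brackets between `G₁` and `G₂` vanish. Hence every mixed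
tensor is a cycle, and it is a boundary exactly when its image in the tensor product of the
abelianizations is zero.

The stem conditions come from the twist. Brackets between the copies of `M₁` and `M₂` span the
tensor summand, which therefore lies in the derived subalgebra. A bracket sees only the abelianized
classes of the first two coordinates in its tensor part, and these classes are zero on the kernel;
this gives centrality. -/

theorem map_derived_le {δ : M →ₗ[F] G} (hδ : ∀ x y, δ ⁅x, y⁆ = ⁅δ x, δ y⁆) :
    (derived F M).map δ ≤ derived F G := by
  rw [derived, Submodule.map_span, Submodule.span_le]
  rintro _ ⟨_, ⟨x, y, rfl⟩, rfl⟩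
  rw [hδ]
  exact br_mem_derived F G _ _

/-- Brackets lift along a surjection. Equality, not just inclusion, is needed to compute the kernel
of `M → G^ab`. -/
theorem map_derived_of_surjective {δ : M →ₗ[F] G} (hδ : ∀ x y, δ ⁅x, y⁆ = ⁅δ x, δ y⁆)
    (hs : Function.Surjective δ) : (derived F M).map δ = derived F G := by
  refine le_antisymm (map_derived_le hδ) (Submodule.span_le.2 ?_)
  rintro _ ⟨x, y, rfl⟩
  obtain ⟨x, rfl⟩ := hs x
  obtain ⟨y, rfl⟩ := hs y
  exact ⟨⁅x, y⁆, br_mem_derived F M x y, hδ x y⟩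

/-- A surjective homomorphism whose kernel lies in the derived subalgebra induces an isomorphism of
abelianizations. -/
def abEquiv (δ : M →ₗ[F] G) (hδ : ∀ x y, δ ⁅x, y⁆ = ⁅δ x, δ y⁆) (hs : Function.Surjective δ)
    (hk : LinearMap.ker δ ≤ derived F M) : Ab F M ≃ₗ[F] Ab F G :=
  Submodule.quotEquivOfEq _ _ (by
      -- The kernel of `M → G^ab` is `M² + ker δ`, and `ker δ` is absorbed by `M²`.
      rw [LinearMap.ker_comp, Submodule.ker_mkQ, ← map_derived_of_surjective hδ hs,
        Submodule.comap_map_eq, sup_eq_left.2 hk]) ≪≫ₗ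
    (toAb F G ∘ₗ δ).quotKerEquivOfSurjective ((Submodule.mkQ_surjective _).comp hs)

end Abelianization

/-! ### The tensor product of two abelian Leibniz algebras acting trivially on each other -/

/-- The vector space `V` with the zero multiplication. -/
def ZeroMul (V : Type*) : Type _ := V

namespace ZeroMul

variable {F V : Type*} [Field F] [AddCommGroup V] [Module F V]

instance : AddCommGroup (ZeroMul V) := inferInstanceAs (AddCommGroup V)

instance : Module F (ZeroMul V) := inferInstanceAs (Module F V)

/-- The universal property of the free algebra needs an algebra as target. The zero product is the
right one, because trivial actions make every product of symbols zero. -/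
instance : NonUnitalNonAssocSemiring (ZeroMul V) where
  mul _ _ := 0
  left_distrib _ _ _ := (add_zero 0).symm
  right_distrib _ _ _ := (add_zero 0).symm
  zero_mul _ := rfl
  mul_zero _ := rfl

theorem mul_eq_zero (x y : ZeroMul V) : x * y = 0 := rfl

instance : IsScalarTower F (ZeroMul V) (ZeroMul V) where
  smul_assoc c x y := by simp [mul_eq_zero]

instance : SMulCommClass F (ZeroMul V) (ZeroMul V) where
  smul_comm c x y := by simp [mul_eq_zero]

end ZeroMul

section TrivialTensor

variable (F A B : Type*) [Field F] [AddCommGroup A] [Module F A] [AddCommGroup B] [Module F B]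

/-- The evaluation of the symbols in the sum of the two tensor products. -/
def evalSymbols : FreeSymbols F A B →ₙₐ[F] ZeroMul ((A ⊗[F] B) × (B ⊗[F] A)) :=
  FreeNonUnitalNonAssocAlgebra.lift F
    (Sum.elim (fun p => (p.1 ⊗ₜ[F] p.2, 0)) (fun p => (0, p.1 ⊗ₜ[F] p.2)) :
      (A × B) ⊕ (B × A) → (A ⊗[F] B) × (B ⊗[F] A))

/-- The linear map underlying `evalSymbols`. -/
def evalSymbolsLinear : FreeSymbols F A B →ₗ[F] (A ⊗[F] B) × (B ⊗[F] A) where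
  toFun := evalSymbols F A B
  map_add' := map_add (evalSymbols F A B)
  map_smul' := map_smul (evalSymbols F A B)

@[simp] theorem evalSymbolsLinear_symMN (a : A) (b : B) :
    evalSymbolsLinear F A B (symMN F a b) = (a ⊗ₜ b, 0) :=
  FreeNonUnitalNonAssocAlgebra.lift_of_apply F (A := ZeroMul ((A ⊗[F] B) × (B ⊗[F] A))) _ _

@[simp] theorem evalSymbolsLinear_symNM (b : B) (a : A) :
    evalSymbolsLinear F A B (symNM F b a) = (0, b ⊗ₜ a) :=
  FreeNonUnitalNonAssocAlgebra.lift_of_apply F (A := ZeroMul ((A ⊗[F] B) × (B ⊗[F] A))) _ _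

@[simp] theorem evalSymbolsLinear_mul (u v : FreeSymbols F A B) :
    evalSymbolsLinear F A B (u * v) = 0 :=
  map_mul (evalSymbols F A B) u v

variable [LeibnizAlgebra F A] [LeibnizAlgebra F B]

/-- The tensor product of two Leibniz algebras acting trivially on each other. -/
abbrev TrivialTensor : Type _ :=
  NonabelianTensor (Action.trivial F B A) (Action.trivial F A B)

/-- The map from the sum of the two tensor products of vector spaces. -/
def ofTensors : (A ⊗[F] B) × (B ⊗[F] A) →ₗ[F] TrivialTensor F A B :=
  (TensorProduct.lift (tMN (Action.trivial F B A) (Action.trivial F A B))).coprod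
    (TensorProduct.lift (tNM (Action.trivial F B A) (Action.trivial F A B)))

variable {F A B}

/-- Apart from bilinearity, both sides of every relation evaluate to zero: each term contains a
product, an acted-on element or a bracket. The vanishing of brackets matters for symbols such as `a
∗ [b, b']`. -/
theorem evalSymbolsLinear_eq_of_rel (hA : ∀ x y : A, ⁅x, y⁆ = 0) (hB : ∀ x y : B, ⁅x, y⁆ = 0)
    {u v : FreeSymbols F A B} (h : TensorRel (Action.trivial F B A) (Action.trivial F A B) u v) :
    evalSymbolsLinear F A B u = evalSymbolsLinear F A B v := by
  cases h <;>
    simp [hA, hB, Action.trivial, add_tmul, tmul_add, smul_tmul', ← Prod.zero_eq_mk]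

theorem tensorIdeal_le_ker (hA : ∀ x y : A, ⁅x, y⁆ = 0) (hB : ∀ x y : B, ⁅x, y⁆ = 0) :
    tensorIdeal (Action.trivial F B A) (Action.trivial F A B) ≤
      LinearMap.ker (evalSymbolsLinear F A B) := by
  refine sInf_le ⟨fun u v h => ?_, fun u v _ => ?_, fun u v _ => ?_⟩
  · rw [LinearMap.mem_ker, map_sub, evalSymbolsLinear_eq_of_rel hA hB h, sub_self]
  · exact evalSymbolsLinear_mul F A B u v
  · exact evalSymbolsLinear_mul F A B u v

/-- By bilinearity only pairs of symbols matter, and each of the four kinds of product equals a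
symbol whose entries are results of the actions, hence `0 ∗ 0`. -/
theorem ofTensors_br (s t : (A ⊗[F] B) × (B ⊗[F] A)) :
    ⁅ofTensors F A B s, ofTensors F A B t⁆ = 0 := by
  have hMN {u v : FreeSymbols F A B} (h : TensorRel (Action.trivial F B A) (Action.trivial F A B)
      (u * v) (symMN F 0 0)) :
      (tensorIdeal (Action.trivial F B A) (Action.trivial F A B)).mkQ (u * v) = 0 :=
    ((Submodule.Quotient.eq _).2 (sub_mem_tensorIdeal h)).trans
      (map_zero (tMN (Action.trivial F B A) (Action.trivial F A B) 0))
  have h₁ (a : A) (b : B) : ofTensors F A B (LinearMap.inl F _ _ (a ⊗ₜ b)) =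
      tMN (Action.trivial F B A) (Action.trivial F A B) a b := by simp [ofTensors]
  have h₂ (a : A) (b : B) : ofTensors F A B (LinearMap.inr F _ _ (b ⊗ₜ a)) =
      tNM (Action.trivial F B A) (Action.trivial F A B) b a := by simp [ofTensors]
  suffices h : (br F (TrivialTensor F A B)).compl₁₂ (ofTensors F A B) (ofTensors F A B) = 0 from
    LinearMap.congr_fun₂ h s t
  refine LinearMap.prod_ext (TensorProduct.ext' fun a b => LinearMap.prod_ext
    (TensorProduct.ext' fun a' b' => ?_) (TensorProduct.ext' fun b' a' => ?_))
    (TensorProduct.ext' fun b a => LinearMap.prod_ext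
    (TensorProduct.ext' fun a' b' => ?_) (TensorProduct.ext' fun b' a' => ?_))
  · simp only [LinearMap.comp_apply, LinearMap.compl₁₂_apply, LinearMap.zero_apply, h₁]
    exact hMN (TensorRel.mul_MN_MN a b a' b')
  · simp only [LinearMap.comp_apply, LinearMap.compl₁₂_apply, LinearMap.zero_apply, h₁, h₂]
    exact hMN (TensorRel.mul_MN_NM a b b' a')
  · simp only [LinearMap.comp_apply, LinearMap.compl₁₂_apply, LinearMap.zero_apply, h₁, h₂]
    exact hMN (TensorRel.mul_NM_MN b a a' b')
  · simp only [LinearMap.comp_apply, LinearMap.compl₁₂_apply, LinearMap.zero_apply, h₂]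
    exact hMN (TensorRel.mul_NM_NM b a b' a')

variable (F A B) in
-- The free algebra is spanned by non-associative words. Words of length one are images of pure
-- tensors, and longer words become zero.
theorem mkQ_mem_range_ofTensors (u : FreeSymbols F A B) :
    (tensorIdeal (Action.trivial F B A) (Action.trivial F A B)).mkQ u ∈
      LinearMap.range (ofTensors F A B) := by
  induction u using MonoidAlgebra.induction_linear with
  | zero => simp
  | add u v hu hv => simpa only [map_add] using add_mem hu hv
  | single g r =>
    suffices h : (tensorIdeal (Action.trivial F B A) (Action.trivial F A B)).mkQ
        (MonoidAlgebra.single g 1) ∈ LinearMap.range (ofTensors F A B) by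
      have e : MonoidAlgebra.single g r = r • MonoidAlgebra.single g (1 : F) := by simp
      rw [e, map_smul]
      exact Submodule.smul_mem _ r h
    induction g with
    | ih1 p =>
      rcases p with ⟨a, b⟩ | ⟨b, a⟩
      · exact ⟨(a ⊗ₜ b, 0), by simp [ofTensors]; rfl⟩
      · exact ⟨(0, b ⊗ₜ a), by simp [ofTensors]; rfl⟩
    | ih2 g h hg hh =>
      obtain ⟨s, hs⟩ := hg
      obtain ⟨t, ht⟩ := hh
      -- Both factors already lie in the range, where all brackets vanish, so the product is the
      -- image of zero.
      refine ⟨0, ?_⟩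
      have e : MonoidAlgebra.single (g * h) (1 : F) =
        MonoidAlgebra.single g 1 * MonoidAlgebra.single h 1 := by simp
      rw [map_zero, ← ofTensors_br s t, hs, ht, e]
      rfl

theorem ofTensors_surjective : Function.Surjective (ofTensors F A B) := fun x => by
  obtain ⟨u, rfl⟩ := Submodule.mkQ_surjective _ x
  exact mkQ_mem_range_ofTensors F A B u

/-- The tensor product of two abelian Leibniz algebras acting trivially on each other is the sum of
the two tensor products of vector spaces. -/
def tensorsEquiv (hA : ∀ x y : A, ⁅x, y⁆ = 0) (hB : ∀ x y : B, ⁅x, y⁆ = 0) :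
    ((A ⊗[F] B) × (B ⊗[F] A)) ≃ₗ[F] TrivialTensor F A B :=
  LinearEquiv.ofBijective (ofTensors F A B) ⟨by
    -- Evaluation of symbols descends to the quotient and is a left inverse, which gives
    -- injectivity.
    have h : (Submodule.liftQ _ (evalSymbolsLinear F A B) (tensorIdeal_le_ker hA hB)) ∘ₗ
        ofTensors F A B = LinearMap.id := by
      refine LinearMap.prod_ext (TensorProduct.ext' fun a b => ?_)
        (TensorProduct.ext' fun b a => ?_)
      · simp only [ofTensors, LinearMap.comp_apply, LinearMap.inl_apply,
          LinearMap.coprod_apply, map_zero, add_zero, TensorProduct.lift.tmul]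
        exact evalSymbolsLinear_symMN F A B a b
      · simp only [ofTensors, LinearMap.comp_apply, LinearMap.inr_apply,
          LinearMap.coprod_apply, map_zero, zero_add, TensorProduct.lift.tmul]
        exact evalSymbolsLinear_symNM F A B b a
    exact Function.LeftInverse.injective (LinearMap.congr_fun h), ofTensors_surjective⟩

end TrivialTensor

/-! ### The second homology of a direct sum -/

section Kunneth

/-! ### Functoriality of cycles and boundaries -/

section Functoriality

variable {F L L' : Type*} [Field F] [AddCommGroup L] [Module F L] [LeibnizAlgebra F L]
  [AddCommGroup L'] [Module F L'] [LeibnizAlgebra F L']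

theorem boundary₂_map {f : L →ₗ[F] L'} (hf : ∀ x y, f ⁅x, y⁆ = ⁅f x, f y⁆) (t : L ⊗[F] L) :
    boundary₂ F L' (TensorProduct.map f f t) = f (boundary₂ F L t) := by
  suffices h : boundary₂ F L' ∘ₗ TensorProduct.map f f = f ∘ₗ boundary₂ F L from
    LinearMap.congr_fun h t
  ext x y
  simp [hf]

theorem boundary₃_map {f : L →ₗ[F] L'} (hf : ∀ x y, f ⁅x, y⁆ = ⁅f x, f y⁆)
    (t : (L ⊗[F] L) ⊗[F] L) :
    boundary₃ F L' (TensorProduct.map (TensorProduct.map f f) f t) =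
      TensorProduct.map f f (boundary₃ F L t) := by
  suffices h : boundary₃ F L' ∘ₗ TensorProduct.map (TensorProduct.map f f) f =
      TensorProduct.map f f ∘ₗ boundary₃ F L from LinearMap.congr_fun h t
  ext x y z
  simp [hf]

/-- The map induced on 2-cycles by a homomorphism. -/
def cyclesMap (f : L →ₗ[F] L') (hf : ∀ x y, f ⁅x, y⁆ = ⁅f x, f y⁆) :
    LinearMap.ker (boundary₂ F L) →ₗ[F] LinearMap.ker (boundary₂ F L') :=
  (TensorProduct.map f f).restrict fun t ht => by
    rw [LinearMap.mem_ker] at ht ⊢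
    rw [boundary₂_map hf, ht, map_zero]

/-- If `f : L → H` and `g : L' → H` are homomorphisms whose images annihilate each other, then the
kernel of `L ⊗ L' → L^ab ⊗ L'^ab` is sent to boundaries. -/
theorem map_mem_range_boundary₃_of_commute {F L L' H : Type*} [Field F]
    [AddCommGroup L] [Module F L] [LeibnizAlgebra F L]
    [AddCommGroup L'] [Module F L'] [LeibnizAlgebra F L']
    [AddCommGroup H] [Module F H] [LeibnizAlgebra F H] {f : L →ₗ[F] H} {g : L' →ₗ[F] H}
    (hf : ∀ x y, f ⁅x, y⁆ = ⁅f x, f y⁆) (hg : ∀ x y, g ⁅x, y⁆ = ⁅g x, g y⁆)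
    (hfg : ∀ x y, ⁅f x, g y⁆ = 0) (u : L ⊗[F] L')
    (hu : TensorProduct.map (toAb F L) (toAb F L') u = 0) :
    TensorProduct.map f g u ∈ LinearMap.range (boundary₃ F H) := by
  -- Right exactness: the kernel is generated by tensors with one factor in a derived subalgebra.
  have hk := TensorProduct.map_ker (g := toAb F L) (g' := toAb F L')
    (f := (derived F L).subtype) (f' := (derived F L').subtype)
    (LinearMap.exact_subtype_mkQ _) (Submodule.mkQ_surjective _)
    (LinearMap.exact_subtype_mkQ _) (Submodule.mkQ_surjective _)
  have hu' : u ∈ LinearMap.ker (TensorProduct.map (toAb F L) (toAb F L')) := hu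
  rw [hk] at hu'
  refine (sup_le (a := LinearMap.range (LinearMap.lTensor L (derived F L').subtype))
    (c := (LinearMap.range (boundary₃ F H)).comap
      (TensorProduct.map f g)) ?_ ?_) hu'
  · rintro _ ⟨t, rfl⟩
    induction t with
    | zero => simp
    | add s t hs ht => simpa only [map_add] using add_mem hs ht
    | tmul x y =>
      obtain ⟨y, hy⟩ := y
      induction hy using Submodule.span_induction with
      | mem _ h =>
        obtain ⟨y, z, rfl⟩ := h
        -- In `∂₃ (f x ⊗ g y ⊗ g z)` only `-f x ⊗ [g y, g z]` survives, whence the sign.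
        exact ⟨-((f x ⊗ₜ g y) ⊗ₜ g z),
          by simp [hg, hfg]⟩
      | zero => simp
      | add y z _ _ hy hz => simpa [tmul_add] using add_mem hy hz
      | smul c y _ hy => simpa using Submodule.smul_mem _ c hy
  · rintro _ ⟨t, rfl⟩
    induction t with
    | zero => simp
    | add s t hs ht => simpa only [map_add] using add_mem hs ht
    | tmul x y =>
      obtain ⟨x, hx⟩ := x
      induction hx using Submodule.span_induction with
      | mem _ h =>
        obtain ⟨x, z, rfl⟩ := h
        -- Here only the first term `[f x, f z] ⊗ g y` of `∂₃` survives.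
        exact ⟨(f x ⊗ₜ f z) ⊗ₜ g y,
          by simp [hf, hfg]⟩
      | zero => simp
      | add y z _ _ hy hz => simpa [add_tmul] using add_mem hy hz
      | smul c y _ hy => simpa [smul_tmul'] using Submodule.smul_mem _ c hy

@[simp] theorem cyclesMap_coe (f : L →ₗ[F] L') (hf : ∀ x y, f ⁅x, y⁆ = ⁅f x, f y⁆)
    (t : LinearMap.ker (boundary₂ F L)) :
    (cyclesMap f hf t : L' ⊗[F] L') = TensorProduct.map f f t := rfl

theorem map_mem_range_boundary₃ {f : L →ₗ[F] L'} (hf : ∀ x y, f ⁅x, y⁆ = ⁅f x, f y⁆)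
    {t : L ⊗[F] L} (ht : t ∈ LinearMap.range (boundary₃ F L)) :
    TensorProduct.map f f t ∈ LinearMap.range (boundary₃ F L') := by
  obtain ⟨s, rfl⟩ := ht
  exact ⟨_, boundary₃_map hf s⟩

/-- A surjective linear map on 2-cycles whose kernel consists of the boundaries identifies the
second homology with its target. -/
def HL₂.equivOfSurjective {V : Type*} [AddCommGroup V] [Module F V]
    (f : LinearMap.ker (boundary₂ F L) →ₗ[F] V) (hs : Function.Surjective f)
    (hk : LinearMap.ker f =
      (LinearMap.range (boundary₃ F L)).submoduleOf (LinearMap.ker (boundary₂ F L))) :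
    HL₂ F L ≃ₗ[F] V :=
  Submodule.quotEquivOfEq _ _ hk.symm ≪≫ₗ f.quotKerEquivOfSurjective hs

end Functoriality

/-! ### Components of the tensor square and the Künneth formula -/

variable (F G₁ G₂ : Type*) [Field F] [AddCommGroup G₁] [Module F G₁] [AddCommGroup G₂]
  [Module F G₂]

variable {G₁ G₂} in
/-- The tensor in `G ⊗ G` with given components, for `G = G₁ ⊕ G₂`. -/
def ofComponents (a : G₁ ⊗[F] G₁) (b : G₂ ⊗[F] G₂) (c : G₁ ⊗[F] G₂) (d : G₂ ⊗[F] G₁) :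
    (G₁ × G₂) ⊗[F] (G₁ × G₂) :=
  TensorProduct.map (.inl F G₁ G₂) (.inl F G₁ G₂) a +
    TensorProduct.map (.inr F G₁ G₂) (.inr F G₁ G₂) b +
    TensorProduct.map (.inl F G₁ G₂) (.inr F G₁ G₂) c +
    TensorProduct.map (.inr F G₁ G₂) (.inl F G₁ G₂) d

theorem map_ofComponents {V V' : Type*} [AddCommGroup V] [Module F V] [AddCommGroup V']
    [Module F V'] (f : G₁ × G₂ →ₗ[F] V) (g : G₁ × G₂ →ₗ[F] V') (a : G₁ ⊗[F] G₁)
    (b : G₂ ⊗[F] G₂) (c : G₁ ⊗[F] G₂) (d : G₂ ⊗[F] G₁) :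
    TensorProduct.map f g (ofComponents F a b c d) =
      TensorProduct.map (f ∘ₗ .inl F G₁ G₂) (g ∘ₗ .inl F G₁ G₂) a +
        TensorProduct.map (f ∘ₗ .inr F G₁ G₂) (g ∘ₗ .inr F G₁ G₂) b +
        TensorProduct.map (f ∘ₗ .inl F G₁ G₂) (g ∘ₗ .inr F G₁ G₂) c +
        TensorProduct.map (f ∘ₗ .inr F G₁ G₂) (g ∘ₗ .inl F G₁ G₂) d := by
  simp only [ofComponents, map_add, TensorProduct.map_comp, LinearMap.comp_apply]

/-- The identity of `G₁ × G₂` is `inl ∘ fst + inr ∘ snd`; expand this in both tensor factors. -/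
theorem eq_ofComponents (t : (G₁ × G₂) ⊗[F] (G₁ × G₂)) :
    t = ofComponents F (TensorProduct.map (.fst F G₁ G₂) (.fst F G₁ G₂) t)
      (TensorProduct.map (.snd F G₁ G₂) (.snd F G₁ G₂) t)
      (TensorProduct.map (.fst F G₁ G₂) (.snd F G₁ G₂) t)
      (TensorProduct.map (.snd F G₁ G₂) (.fst F G₁ G₂) t) := by
  rw [ofComponents]
  induction t with
  | zero => simp
  | add s t hs ht =>
    conv_lhs => rw [hs, ht]
    simp only [map_add]
    abel
  | tmul x y =>
    obtain ⟨x₁, x₂⟩ := x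
    obtain ⟨y₁, y₂⟩ := y
    have hx : ((x₁, x₂) : G₁ × G₂) = (x₁, 0) + (0, x₂) := by simp
    have hy : ((y₁, y₂) : G₁ × G₂) = (y₁, 0) + (0, y₂) := by simp
    conv_lhs => rw [hx, hy, add_tmul, tmul_add, tmul_add]
    simp only [TensorProduct.map_tmul, LinearMap.inl_apply, LinearMap.inr_apply,
      LinearMap.fst_apply, LinearMap.snd_apply]
    abel

variable [LeibnizAlgebra F G₁] [LeibnizAlgebra F G₂]

theorem fst_br (x y : G₁ × G₂) : LinearMap.fst F G₁ G₂ ⁅x, y⁆ =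
    ⁅LinearMap.fst F G₁ G₂ x, LinearMap.fst F G₁ G₂ y⁆ := rfl

theorem snd_br (x y : G₁ × G₂) : LinearMap.snd F G₁ G₂ ⁅x, y⁆ =
    ⁅LinearMap.snd F G₁ G₂ x, LinearMap.snd F G₁ G₂ y⁆ := rfl

theorem prod_br (x x' : G₁) (y y' : G₂) : ⁅(x, y), (x', y')⁆ = (⁅x, x'⁆, ⁅y, y'⁆) := rfl

theorem inl_br (x y : G₁) : LinearMap.inl F G₁ G₂ ⁅x, y⁆ =
    ⁅LinearMap.inl F G₁ G₂ x, LinearMap.inl F G₁ G₂ y⁆ := by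
  simp [prod_br, zero_br F G₂]

theorem inr_br (x y : G₂) : LinearMap.inr F G₁ G₂ ⁅x, y⁆ =
    ⁅LinearMap.inr F G₁ G₂ x, LinearMap.inr F G₁ G₂ y⁆ := by
  simp [prod_br, zero_br F G₁]

theorem inl_br_inr (x : G₁) (y : G₂) : ⁅LinearMap.inl F G₁ G₂ x, LinearMap.inr F G₁ G₂ y⁆ = 0 := by
  simp [prod_br, zero_br F G₂, br_zero F G₁]

theorem inr_br_inl (x : G₂) (y : G₁) : ⁅LinearMap.inr F G₁ G₂ x, LinearMap.inl F G₁ G₂ y⁆ = 0 := by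
  simp [prod_br, zero_br F G₁, br_zero F G₂]

/-- The mixed component `G ⊗ G → G₁^ab ⊗ G₂^ab` for `G = G₁ ⊕ G₂`. -/
def mixed₁₂ : (G₁ × G₂) ⊗[F] (G₁ × G₂) →ₗ[F] Ab F G₁ ⊗[F] Ab F G₂ :=
  TensorProduct.map (toAb F G₁ ∘ₗ LinearMap.fst F G₁ G₂) (toAb F G₂ ∘ₗ LinearMap.snd F G₁ G₂)

/-- The mixed component `G ⊗ G → G₂^ab ⊗ G₁^ab` for `G = G₁ ⊕ G₂`. -/
def mixed₂₁ : (G₁ × G₂) ⊗[F] (G₁ × G₂) →ₗ[F] Ab F G₂ ⊗[F] Ab F G₁ :=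
  TensorProduct.map (toAb F G₂ ∘ₗ LinearMap.snd F G₁ G₂) (toAb F G₁ ∘ₗ LinearMap.fst F G₁ G₂)

/-- Every term of `∂₃` has a bracket as one of its tensor factors, and abelianization kills it. -/
theorem mixed₁₂_boundary₃ (t) : mixed₁₂ F G₁ G₂ (boundary₃ F (G₁ × G₂) t) = 0 := by
  suffices h : mixed₁₂ F G₁ G₂ ∘ₗ boundary₃ F (G₁ × G₂) = 0 from LinearMap.congr_fun h t
  refine TensorProduct.ext_threefold fun x y z => ?_
  have h₁ (u v : G₁ × G₂) : toAb F G₁ ⁅u, v⁆.1 = 0 := toAb_br F G₁ u.1 v.1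
  have h₂ (u v : G₁ × G₂) : toAb F G₂ ⁅u, v⁆.2 = 0 := toAb_br F G₂ u.2 v.2
  simp [mixed₁₂, -Submodule.mkQ_apply, h₁, h₂]

theorem mixed₂₁_boundary₃ (t) : mixed₂₁ F G₁ G₂ (boundary₃ F (G₁ × G₂) t) = 0 := by
  suffices h : mixed₂₁ F G₁ G₂ ∘ₗ boundary₃ F (G₁ × G₂) = 0 from LinearMap.congr_fun h t
  refine TensorProduct.ext_threefold fun x y z => ?_
  have h₁ (u v : G₁ × G₂) : toAb F G₁ ⁅u, v⁆.1 = 0 := toAb_br F G₁ u.1 v.1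
  have h₂ (u v : G₁ × G₂) : toAb F G₂ ⁅u, v⁆.2 = 0 := toAb_br F G₂ u.2 v.2
  simp [mixed₂₁, -Submodule.mkQ_apply, h₁, h₂]

/-- The Künneth map on 2-cycles of a direct sum. -/
def kunneth : LinearMap.ker (boundary₂ F (G₁ × G₂)) →ₗ[F]
    (HL₂ F G₁ × HL₂ F G₂) × ((Ab F G₁ ⊗[F] Ab F G₂) × (Ab F G₂ ⊗[F] Ab F G₁)) :=
  ((Submodule.mkQ _ ∘ₗ cyclesMap _ (fst_br F G₁ G₂)).prod
    (Submodule.mkQ _ ∘ₗ cyclesMap _ (snd_br F G₁ G₂))).prod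
  (((mixed₁₂ F G₁ G₂).prod (mixed₂₁ F G₁ G₂)) ∘ₗ Submodule.subtype _)

theorem boundary₂_mixed₁₂ (t : G₁ ⊗[F] G₂) : boundary₂ F (G₁ × G₂)
    (TensorProduct.map (.inl F G₁ G₂) (.inr F G₁ G₂) t) = 0 := by
  suffices h : boundary₂ F (G₁ × G₂) ∘ₗ
      TensorProduct.map (.inl F G₁ G₂) (.inr F G₁ G₂) = 0 from LinearMap.congr_fun h t
  refine TensorProduct.ext' fun x y => ?_
  simp [prod_br, zero_br F G₂, br_zero F G₁]

theorem boundary₂_mixed₂₁ (t : G₂ ⊗[F] G₁) : boundary₂ F (G₁ × G₂)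
    (TensorProduct.map (.inr F G₁ G₂) (.inl F G₁ G₂) t) = 0 := by
  suffices h : boundary₂ F (G₁ × G₂) ∘ₗ
      TensorProduct.map (.inr F G₁ G₂) (.inl F G₁ G₂) = 0 from LinearMap.congr_fun h t
  refine TensorProduct.ext' fun x y => ?_
  simp [prod_br, zero_br F G₁, br_zero F G₂]

theorem kunneth_apply (t : LinearMap.ker (boundary₂ F (G₁ × G₂))) : kunneth F G₁ G₂ t =
    ((Submodule.mkQ _ (cyclesMap _ (fst_br F G₁ G₂) t),
      Submodule.mkQ _ (cyclesMap _ (snd_br F G₁ G₂) t)),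
      (mixed₁₂ F G₁ G₂ t.1, mixed₂₁ F G₁ G₂ t.1)) := rfl

/-- The four components can be prescribed independently: cycles of each `Gᵢ` stay cycles, and mixed
tensors are always cycles. -/
theorem kunneth_surjective : Function.Surjective (kunneth F G₁ G₂) := by
  rintro ⟨⟨a, b⟩, c, d⟩
  obtain ⟨a, rfl⟩ := Submodule.mkQ_surjective _ a
  obtain ⟨b, rfl⟩ := Submodule.mkQ_surjective _ b
  obtain ⟨c, rfl⟩ := TensorProduct.map_surjective (Submodule.mkQ_surjective (derived F G₁))
    (Submodule.mkQ_surjective (derived F G₂)) c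
  obtain ⟨d, rfl⟩ := TensorProduct.map_surjective (Submodule.mkQ_surjective (derived F G₂))
    (Submodule.mkQ_surjective (derived F G₁)) d
  let t : LinearMap.ker (boundary₂ F (G₁ × G₂)) :=
    cyclesMap _ (inl_br F G₁ G₂) a + cyclesMap _ (inr_br F G₁ G₂) b +
      ⟨_, boundary₂_mixed₁₂ F G₁ G₂ c⟩ + ⟨_, boundary₂_mixed₂₁ F G₁ G₂ d⟩
  have ht : t.1 = ofComponents F a.1 b.1 c d := rfl
  have h₁ : cyclesMap _ (fst_br F G₁ G₂) t = a := Subtype.ext <| by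
    rw [cyclesMap_coe, ht, map_ofComponents]
    simp
  have h₂ : cyclesMap _ (snd_br F G₁ G₂) t = b := Subtype.ext <| by
    rw [cyclesMap_coe, ht, map_ofComponents]
    simp
  refine ⟨t, ?_⟩
  rw [kunneth_apply, h₁, h₂, ht, mixed₁₂, mixed₂₁, map_ofComponents, map_ofComponents]
  simp [LinearMap.comp_assoc]

/-- A cycle in the kernel is a boundary component by component: the diagonal components by
functoriality, the mixed ones by `map_mem_range_boundary₃_of_commute`. -/
theorem ker_kunneth : LinearMap.ker (kunneth F G₁ G₂) =
    (LinearMap.range (boundary₃ F (G₁ × G₂))).submoduleOf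
      (LinearMap.ker (boundary₂ F (G₁ × G₂))) := by
  ext ⟨t, ht⟩
  have h : kunneth F G₁ G₂ ⟨t, ht⟩ = 0 ↔
      (TensorProduct.map (.fst F G₁ G₂) (.fst F G₁ G₂) t ∈ LinearMap.range (boundary₃ F G₁) ∧
        TensorProduct.map (.snd F G₁ G₂) (.snd F G₁ G₂) t ∈ LinearMap.range (boundary₃ F G₂)) ∧
      mixed₁₂ F G₁ G₂ t = 0 ∧ mixed₂₁ F G₁ G₂ t = 0 := by
    simp only [Prod.ext_iff]
    exact and_congr (and_congr (Submodule.Quotient.mk_eq_zero _) (Submodule.Quotient.mk_eq_zero _))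
      Iff.rfl
  rw [LinearMap.mem_ker, h]
  change _ ↔ t ∈ LinearMap.range (boundary₃ F (G₁ × G₂))
  constructor
  · rintro ⟨⟨h₁, h₂⟩, h₃, h₄⟩
    -- Separating projection from abelianization says that the mixed component of `t` dies in the
    -- tensor product of the abelianizations.
    rw [mixed₁₂, TensorProduct.map_comp] at h₃
    rw [mixed₂₁, TensorProduct.map_comp] at h₄
    rw [eq_ofComponents F G₁ G₂ t]
    exact add_mem (add_mem (add_mem (map_mem_range_boundary₃ (inl_br F G₁ G₂) h₁)
      (map_mem_range_boundary₃ (inr_br F G₁ G₂) h₂)) (map_mem_range_boundary₃_of_commute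
      (inl_br F G₁ G₂) (inr_br F G₁ G₂) (inl_br_inr F G₁ G₂) _ h₃))
      (map_mem_range_boundary₃_of_commute (inr_br F G₁ G₂) (inl_br F G₁ G₂)
      (inr_br_inl F G₁ G₂) _ h₄)
  · rintro hs
    refine ⟨⟨map_mem_range_boundary₃ (fst_br F G₁ G₂) hs,
      map_mem_range_boundary₃ (snd_br F G₁ G₂) hs⟩, ?_⟩
    obtain ⟨s, rfl⟩ := hs
    exact ⟨mixed₁₂_boundary₃ F G₁ G₂ s, mixed₂₁_boundary₃ F G₁ G₂ s⟩

/-- The Künneth formula for the second homology of a direct sum. -/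
def kunnethEquiv : HL₂ F (G₁ × G₂) ≃ₗ[F]
    (HL₂ F G₁ × HL₂ F G₂) × ((Ab F G₁ ⊗[F] Ab F G₂) × (Ab F G₂ ⊗[F] Ab F G₁)) :=
  HL₂.equivOfSurjective (kunneth F G₁ G₂) (kunneth_surjective F G₁ G₂) (ker_kunneth F G₁ G₂)

end Kunneth

/-! ### The twisted sum -/

namespace TwistedSum

variable {F G₁ G₂ M₁ M₂ : Type*} [Field F]
  [AddCommGroup G₁] [Module F G₁] [AddCommGroup G₂] [Module F G₂]
  [AddCommGroup M₁] [Module F M₁] [LeibnizAlgebra F M₁]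
  [AddCommGroup M₂] [Module F M₂] [LeibnizAlgebra F M₂]

theorem mem_ker_proj {δ₁ : M₁ →ₗ[F] G₁} {δ₂ : M₂ →ₗ[F] G₂} {x : TwistedSum F M₁ M₂} :
    x ∈ LinearMap.ker (proj δ₁ δ₂) ↔ δ₁ x.fst = 0 ∧ δ₂ x.snd = 0 := Prod.ext_iff

/-- The kernel of the projection of a twisted sum. -/
def kerProjEquiv (δ₁ : M₁ →ₗ[F] G₁) (δ₂ : M₂ →ₗ[F] G₂) : LinearMap.ker (proj δ₁ δ₂) ≃ₗ[F]
    (LinearMap.ker δ₁ × LinearMap.ker δ₂) × AbTensor F M₁ M₂ where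
  toFun x := ((⟨x.1.fst, (mem_ker_proj.1 x.2).1⟩, ⟨x.1.snd, (mem_ker_proj.1 x.2).2⟩), x.1.tensor)
  invFun y := ⟨⟨y.1.1, y.1.2, y.2⟩, mem_ker_proj.2 ⟨y.1.1.2, y.1.2.2⟩⟩
  left_inv _ := rfl
  right_inv _ := rfl
  map_add' _ _ := rfl
  map_smul' _ _ := rfl

theorem bracket_def (x y : TwistedSum F M₁ M₂) : ⁅x, y⁆ =
    ⟨⁅x.fst, y.fst⁆, ⁅x.snd, y.snd⁆, star₁₂ F y.fst x.snd - star₂₁ F y.snd x.fst⟩ := rfl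

variable (F M₁ M₂) in
/-- The inclusion of the first summand. -/
def inl : M₁ →ₗ[F] TwistedSum F M₁ M₂ where
  toFun m := ⟨m, 0, 0⟩
  map_add' _ _ := by ext <;> simp
  map_smul' _ _ := by ext <;> simp

variable (F M₁ M₂) in
/-- The inclusion of the second summand. -/
def inr : M₂ →ₗ[F] TwistedSum F M₁ M₂ where
  toFun m := ⟨0, m, 0⟩
  map_add' _ _ := by ext <;> simp
  map_smul' _ _ := by ext <;> simp

variable (F M₁ M₂) in
/-- The inclusion of the tensor product. -/
def inTensor : AbTensor F M₁ M₂ →ₗ[F] TwistedSum F M₁ M₂ where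
  toFun z := ⟨0, 0, z⟩
  map_add' _ _ := by ext <;> simp
  map_smul' _ _ := by ext <;> simp

theorem eq_inl_add_inr_add_inTensor (x : TwistedSum F M₁ M₂) :
    x = inl F M₁ M₂ x.fst + inr F M₁ M₂ x.snd + inTensor F M₁ M₂ x.tensor := by
  ext <;> simp [inl, inr, inTensor]

theorem inl_br (x y : M₁) : inl F M₁ M₂ ⁅x, y⁆ = ⁅inl F M₁ M₂ x, inl F M₁ M₂ y⁆ := by
  simp [inl, bracket_def, star₁₂, star₂₁, zero_br F M₂]

theorem inr_br (x y : M₂) : inr F M₁ M₂ ⁅x, y⁆ = ⁅inr F M₁ M₂ x, inr F M₁ M₂ y⁆ := by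
  simp [inr, bracket_def, star₁₂, star₂₁, zero_br F M₁]

/-- The order of the bracket decides the kind of symbol: `M₂` before `M₁` gives `x̄ ∗ ȳ`, the
opposite order gives `-(ȳ ∗ x̄)`. -/
theorem inTensor_star₁₂ (x : M₁) (y : M₂) :
    inTensor F M₁ M₂ (star₁₂ F x y) = ⁅inr F M₁ M₂ y, inl F M₁ M₂ x⁆ := by
  simp [inl, inr, inTensor, bracket_def, star₁₂, star₂₁, zero_br F M₁, br_zero F M₂]

theorem inTensor_star₂₁ (y : M₂) (x : M₁) :
    inTensor F M₁ M₂ (star₂₁ F y x) = - ⁅inl F M₁ M₂ x, inr F M₁ M₂ y⁆ := by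
  have h : ⁅inl F M₁ M₂ x, inr F M₁ M₂ y⁆ = inTensor F M₁ M₂ (-star₂₁ F y x) := by
    simp [inl, inr, inTensor, bracket_def, star₁₂, star₂₁, zero_br F M₂, br_zero F M₁]
  rw [h, map_neg, neg_neg]

/-- No products are needed to span the tensor summand, only the symbols, and these are brackets
between `M₁` and `M₂` up to sign. -/
theorem inTensor_mem_derived (z : AbTensor F M₁ M₂) :
    inTensor F M₁ M₂ z ∈ derived F (TwistedSum F M₁ M₂) := by
  obtain ⟨⟨s, t⟩, rfl⟩ := ofTensors_surjective z
  rw [ofTensors, LinearMap.coprod_apply, map_add]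
  refine add_mem ?_ ?_
  · induction s with
    | zero => simp
    | add s s' hs hs' => simpa only [map_add] using add_mem hs hs'
    | tmul a b =>
      obtain ⟨a, rfl⟩ := Submodule.mkQ_surjective _ a
      obtain ⟨b, rfl⟩ := Submodule.mkQ_surjective _ b
      rw [TensorProduct.lift.tmul]
      exact (inTensor_star₁₂ (F := F) a b).symm ▸ br_mem_derived F _ _ _
  · induction t with
    | zero => simp
    | add s s' hs hs' => simpa only [map_add] using add_mem hs hs'
    | tmul b a =>
      obtain ⟨a, rfl⟩ := Submodule.mkQ_surjective _ a
      obtain ⟨b, rfl⟩ := Submodule.mkQ_surjective _ b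
      rw [TensorProduct.lift.tmul]
      exact (inTensor_star₂₁ (F := F) b a).symm ▸ neg_mem (br_mem_derived F _ _ _)

theorem ker_proj_le_derived {δ₁ : M₁ →ₗ[F] G₁} {δ₂ : M₂ →ₗ[F] G₂}
    (h₁ : LinearMap.ker δ₁ ≤ derived F M₁) (h₂ : LinearMap.ker δ₂ ≤ derived F M₂) :
    LinearMap.ker (proj δ₁ δ₂) ≤ derived F (TwistedSum F M₁ M₂) := fun x hx => by
  obtain ⟨hx₁, hx₂⟩ := mem_ker_proj.1 hx
  rw [eq_inl_add_inr_add_inTensor x]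
  exact add_mem (add_mem (map_derived_le inl_br (Submodule.mem_map_of_mem (h₁ hx₁)))
    (map_derived_le inr_br (Submodule.mem_map_of_mem (h₂ hx₂)))) (inTensor_mem_derived _)

/-- Centrality of `ker δᵢ` handles the first two coordinates of a bracket. The tensor coordinate
requires `ker δᵢ ≤ Mᵢ²`, so that the classes in `Mᵢ^ab` vanish. -/
theorem ker_proj_le_center {δ₁ : M₁ →ₗ[F] G₁} {δ₂ : M₂ →ₗ[F] G₂}
    (h₁ : LinearMap.ker δ₁ ≤ derived F M₁) (h₂ : LinearMap.ker δ₂ ≤ derived F M₂)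
    (hc₁ : LinearMap.ker δ₁ ≤ center F M₁) (hc₂ : LinearMap.ker δ₂ ≤ center F M₂) :
    LinearMap.ker (proj δ₁ δ₂) ≤ center F (TwistedSum F M₁ M₂) := fun x hx y => by
  obtain ⟨hx₁, hx₂⟩ := mem_ker_proj.1 hx
  have e₁ : toAb F M₁ x.fst = 0 := (Submodule.Quotient.mk_eq_zero _).2 (h₁ hx₁)
  have e₂ : toAb F M₂ x.snd = 0 := (Submodule.Quotient.mk_eq_zero _).2 (h₂ hx₂)
  have c₁ := hc₁ hx₁ y.fst
  have c₂ := hc₂ hx₂ y.snd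
  constructor
  · rw [bracket_def, star₁₂, star₂₁, e₁, e₂, c₁.1, c₂.1, map_zero, map_zero, sub_zero]
    rfl
  · rw [bracket_def, star₁₂, star₂₁, e₁, e₂, c₁.2, c₂.2, map_zero, map_zero, LinearMap.zero_apply,
      LinearMap.zero_apply, sub_zero]
    rfl

end TwistedSum

end LeibnizAlgebra

end

/-! ### The stem cover of a direct sum -/

theorem corollary4p6 {F G₁ G₂ M₁ M₂ : Type*} [Field F]
    [AddCommGroup G₁] [Module F G₁] [LeibnizAlgebra F G₁]
    [AddCommGroup G₂] [Module F G₂] [LeibnizAlgebra F G₂]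
    [AddCommGroup M₁] [Module F M₁] [LeibnizAlgebra F M₁]
    [AddCommGroup M₂] [Module F M₂] [LeibnizAlgebra F M₂]
    (δ₁ : M₁ →ₗ[F] G₁) (hδ₁ : LeibnizAlgebra.IsStemCover δ₁)
    (δ₂ : M₂ →ₗ[F] G₂) (hδ₂ : LeibnizAlgebra.IsStemCover δ₂) :
    LeibnizAlgebra.IsStemCover
      (LeibnizAlgebra.TwistedSum.proj (M₁ := M₁) (M₂ := M₂) δ₁ δ₂) where
  map_br x y := Prod.ext (hδ₁.map_br x.fst y.fst) (hδ₂.map_br x.snd y.snd)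
  surjective := fun ⟨x, y⟩ => by
    obtain ⟨x, rfl⟩ := hδ₁.surjective x
    obtain ⟨y, rfl⟩ := hδ₂.surjective y
    exact ⟨⟨x, y, 0⟩, rfl⟩
  ker_le_center := LeibnizAlgebra.TwistedSum.ker_proj_le_center hδ₁.ker_le_derived
    hδ₂.ker_le_derived hδ₁.ker_le_center hδ₂.ker_le_center
  ker_le_derived :=
    LeibnizAlgebra.TwistedSum.ker_proj_le_derived hδ₁.ker_le_derived hδ₂.ker_le_derived
  ker_equiv := by
    obtain ⟨e₁⟩ := hδ₁.ker_equiv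
    obtain ⟨e₂⟩ := hδ₂.ker_equiv
    have a₁ := LeibnizAlgebra.abEquiv δ₁ hδ₁.map_br hδ₁.surjective hδ₁.ker_le_derived
    have a₂ := LeibnizAlgebra.abEquiv δ₂ hδ₂.map_br hδ₂.surjective hδ₂.ker_le_derived
    -- Split the kernel, identify the summands with homology and with tensor products over `Gᵢ^ab`,
    -- then reassemble by Künneth.
    exact ⟨LeibnizAlgebra.TwistedSum.kerProjEquiv δ₁ δ₂ ≪≫ₗ
      ((e₁.prodCongr e₂).prodCongr
        ((LeibnizAlgebra.tensorsEquiv (LeibnizAlgebra.ab_br_eq_zero F M₁)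
          (LeibnizAlgebra.ab_br_eq_zero F M₂)).symm ≪≫ₗ
          (TensorProduct.congr a₁ a₂).prodCongr (TensorProduct.congr a₂ a₁))) ≪≫ₗ
      (LeibnizAlgebra.kunnethEquiv F G₁ G₂).symm⟩
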